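/- An electro-optical transducer has, for its optical and its microwave mode, total loss rates $\gamma_o,\gamma_m>0$ and coupling rates $0\le\gamma_{o,e}\le\gamma_o$, $0\le\gamma_{m,e}\le\gamma_m$, an electro-optic coupling coefficient $g\in\mathbb R$ and an average pump photon number $\langle n\rangle\ge 0$. Its extraction ratios are $\zeta_x=\gamma_{x,e}/\gamma_x$ and its (symmetric) conversion efficiency is $\eta=\gamma_{o,e}\gamma_{m,e}\langle n\rangle g^2/\left|\frac{\gamma_o\gamma_m}{4}+\langle n\rangle g^2\right|^2$. The orchestrator $o$ has a transducer with $\zeta_o=\zeta_m=1$ and efficiency $\eta^o_\uparrow$, initialized with one microwave photon. Its modes obey, at zero detuning, the stationary Heisenberg–Langevin equations $0=ig\sqrt{\langle n\rangle}\,b-\frac{\gamma_o}{2}a+\sqrt{\gamma_{o,e}}\,a_{in}$, $0=ig\sqrt{\langle n\rangle}\,a-\frac{\gamma_m}{2}b+\sqrt{\gamma_{m,e}}\,b_{in}$, $a_{out}=\sqrt{\gamma_{o,e}}\,a-a_{in}$, $b_{out}=\sqrt{\gamma_{m,e}}\,b-b_{in}$, with solution $(a_{out},b_{out})^T=L\,(a_{in},b_{in})^T$,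 and its output state is $|\psi\rangle=(L_{o,m}a^\dagger+L_{m,m}b^\dagger)|0_M0_O\rangle$. The client $c$ has a transducer (with arbitrary extraction ratios) of efficiency $\eta^c_\downarrow$; the fiber between them has length $l_{o,c}\ge 0$ and attenuation length $L_o>0$, that is, the distance a photon travels before absorption is exponentially distributed with mean $L_o$. For a bipartite state $\rho$, the distillable entanglement $E(\rho)$ is the supremum of the $R\ge 0$ such that, for $m\to\infty$, finite-round LOCC protocols turn $\rho^{\otimes m}$ into $n_m$ EPR pairs with fidelity tending to $1$ and $n_m/m\to R$. An ebit is distributed between $o$ and $c$ when three independent events all occur: entanglement is generated, with probability $E(|\psi\rangle\langle\psi|)$ (for the bipartition microwave mode / optical mode); the optical photon is not absorbed in the fiber; it is down-converted at the client, with probability $\eta^c_\downarrow$. Let $p^{IE}_c$ be the probability that all three occur, and let $S(\eta)=-\eta\log_2\eta-(1-\eta)\log_2(1-\eta)$, with $0\log_2 0=0$. Then: (i) up to phase factors of the two terms, $|\psi\rangle$ is the output $\sqrt{\eta^o_\uparrow}\,|0_M1_O\rangle+\sqrt{1-\eta^o_\uparrow}\,|1_M0_O\rangle$ of a lossless beam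 splitter with transmission $\eta^o_\uparrow$; (ii) both reduced states of $|\psi\rangle$ have von Neumann entropy $-\mathrm{Tr}(\rho_A\log_2\rho_A)=S(\eta^o_\uparrow)$; (iii) $E(|\psi\rangle\langle\psi|)=S(\eta^o_\uparrow)$; (iv) $p^{IE}_c=S(\eta^o_\uparrow)\,\eta^c_\downarrow\,e^{-l_{o,c}/L_o}$. -/

import Mathlib

open scoped Kronecker ENNReal NNReal

namespace QTransduction

noncomputable section

/-! ### Electro-optical transducers -/

/-- Hardware parameters of an electro-optical transducer: for the optical (`O`) and the microwave
(`M`) mode the total loss rate `γ` and the coupling (external) rate `γe`; the electro-optic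
coupling coefficient `g`; the average number `N` of pump photons. -/
structure Transducer where
  γO : ℝ
  γeO : ℝ
  γM : ℝ
  γeM : ℝ
  g : ℝ
  N : ℝ
  γO_pos : 0 < γO
  γM_pos : 0 < γM
  γeO_nonneg : 0 ≤ γeO
  γeO_le : γeO ≤ γO
  γeM_nonneg : 0 ≤ γeM
  γeM_le : γeM ≤ γM
  N_nonneg : 0 ≤ N

namespace Transducer

variable (T : Transducer)

/-- Extraction ratio of the optical mode. -/
def extractionO : ℝ := T.γeO / T.γO

/-- Extraction ratio of the microwave mode. -/
def extractionM : ℝ := T.γeM / T.γM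

/-- Conversion efficiency (the same for up- and down-conversion). -/
def efficiency : ℝ :=
  T.γeO * T.γeM * T.N * T.g ^ 2 / |T.γO * T.γM / 4 + T.N * T.g ^ 2| ^ 2

/-- Pump-enhanced coupling rate `g √N` of the beam-splitter Hamiltonian
`g √N (a b† + a† b)`, with `a` the optical and `b` the microwave mode. -/
def coupling : ℝ := T.g * √T.N

/-- The drift of the intracavity modes `(a, b)`, with the sign changed:
`d(a,b)/dt = - drift (a,b) + port (a_in,b_in)`, i.e.
`da/dt = i g√N b - γO/2 a + √γeO a_in` and `db/dt = i g√N a - γM/2 b + √γeM b_in`. -/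
def drift : Matrix (Fin 2) (Fin 2) ℂ :=
  !![((T.γO / 2 : ℝ) : ℂ), -Complex.I * (T.coupling : ℂ);
     -Complex.I * (T.coupling : ℂ), ((T.γM / 2 : ℝ) : ℂ)]

/-- Coupling of the two intracavity modes to their input and output ports. -/
def port : Matrix (Fin 2) (Fin 2) ℂ :=
  !![((√T.γeO : ℝ) : ℂ), 0; 0, ((√T.γeM : ℝ) : ℂ)]

/-- Input-output matrix at zero detuning, `(a_out, b_out) = scattering (a_in, b_in)`
(index `0` optical, index `1` microwave): the stationary solution
`(a,b) = drift⁻¹ port (a_in,b_in)` of the Heisenberg-Langevin equations is inserted into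
`(a_out,b_out) = port (a,b) - (a_in,b_in)`. -/
def scattering : Matrix (Fin 2) (Fin 2) ℂ :=
  T.port * T.drift⁻¹ * T.port - 1

end Transducer

/-! ### Two-level Fock states -/

/-- Creation operator `|1⟩⟨0|` of one mode, on the span of `|0⟩` and `|1⟩`. -/
def creation : Matrix (Fin 2) (Fin 2) ℂ := !![0, 0; 1, 0]

/-- Creation operator of the microwave mode; basis states are indexed by the pair
(number of microwave photons, number of optical photons). -/
def creationM : Matrix (Fin 2 × Fin 2) (Fin 2 × Fin 2) ℂ :=
  creation ⊗ₖ (1 : Matrix (Fin 2) (Fin 2) ℂ)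

/-- Creation operator of the optical mode. -/
def creationO : Matrix (Fin 2 × Fin 2) (Fin 2 × Fin 2) ℂ :=
  (1 : Matrix (Fin 2) (Fin 2) ℂ) ⊗ₖ creation

/-- The vacuum `|0_M 0_O⟩`. -/
def vacuum : Fin 2 × Fin 2 → ℂ := Pi.single (0, 0) 1

/-- Output state of the transducer when it is initialized with one microwave photon: the input
`b_in† |0_M 0_O⟩` leaves as `(L_OM a† + L_MM b†) |0_M 0_O⟩`, where `L` is the input-output
matrix. -/
def Transducer.outputState (T : Transducer) : Fin 2 × Fin 2 → ℂ :=
  (T.scattering 0 1 • creationO + T.scattering 1 1 • creationM).mulVec vacuum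

/-! ### Density matrices and entropy -/

/-- The density matrix `|ψ⟩⟨ψ|`. -/
def pureDensity {A : Type} (ψ : A → ℂ) : Matrix A A ℂ := Matrix.vecMulVec ψ (star ψ)

/-- Reduced density matrix of the first party. -/
def reducedFst {A B : Type} [Fintype B] (ρ : Matrix (A × B) (A × B) ℂ) : Matrix A A ℂ :=
  fun i j => ∑ b, ρ (i, b) (j, b)

/-- Reduced density matrix of the second party. -/
def reducedSnd {A B : Type} [Fintype A] (ρ : Matrix (A × B) (A × B) ℂ) : Matrix B B ℂ :=
  fun i j => ∑ a, ρ (a, i) (a, j)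

/-- Von Neumann entropy `-Tr (ρ log₂ ρ)`, through the functional calculus of Hermitian matrices
(with `0 log₂ 0 = 0`). -/
def vonNeumannEntropy {A : Type} [Fintype A] [DecidableEq A] (ρ : Matrix A A ℂ) : ℝ :=
  -(Matrix.trace (cfc (fun x : ℝ => x * Real.logb 2 x) ρ)).re

/-- The entropy of a two-level state with eigenvalues `η` and `1 - η`, as a function of `η`. -/
def binaryEntropy (η : ℝ) : ℝ :=
  -η * Real.logb 2 η - (1 - η) * Real.logb 2 (1 - η)

/-! ### Distillable entanglement -/

/-- Quantum operations, from states of a bipartite system `A × B` to states of `A' × B'`, that the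
two parties can realize by local operations and classical communication in finitely many rounds. In
a round one party performs a measurement on its system, given by Kraus operators, and announces
the outcome; the rest of the protocol may depend on it. -/
inductive IsLOCC {A' B' : Type} [Fintype A'] [DecidableEq A'] [Fintype B'] [DecidableEq B'] :
    {A B : Type} → [Fintype A] → [DecidableEq A] → [Fintype B] → [DecidableEq B] →
    (Matrix (A × B) (A × B) ℂ → Matrix (A' × B') (A' × B') ℂ) → Prop
  | done : IsLOCC (fun ρ : Matrix (A' × B') (A' × B') ℂ => ρ)
  | first {A B C ι : Type} [Fintype A] [DecidableEq A] [Fintype B] [DecidableEq B]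
      [Fintype C] [DecidableEq C] [Fintype ι]
      (K : ι → Matrix C A ℂ) (complete : ∑ i, (K i).conjTranspose * K i = 1)
      (Λ : ι → Matrix (C × B) (C × B) ℂ → Matrix (A' × B') (A' × B') ℂ)
      (rest : ∀ i, IsLOCC (Λ i)) :
      IsLOCC (fun ρ : Matrix (A × B) (A × B) ℂ =>
        ∑ i, Λ i ((K i ⊗ₖ (1 : Matrix B B ℂ)) * ρ * (K i ⊗ₖ (1 : Matrix B B ℂ)).conjTranspose))
  | second {A B C ι : Type} [Fintype A] [DecidableEq A] [Fintype B] [DecidableEq B]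
      [Fintype C] [DecidableEq C] [Fintype ι]
      (K : ι → Matrix C B ℂ) (complete : ∑ i, (K i).conjTranspose * K i = 1)
      (Λ : ι → Matrix (A × C) (A × C) ℂ → Matrix (A' × B') (A' × B') ℂ)
      (rest : ∀ i, IsLOCC (Λ i)) :
      IsLOCC (fun ρ : Matrix (A × B) (A × B) ℂ =>
        ∑ i, Λ i (((1 : Matrix A A ℂ) ⊗ₖ K i) * ρ * ((1 : Matrix A A ℂ) ⊗ₖ K i).conjTranspose))

/-- The EPR pair `(|00⟩ + |11⟩) / √2`. -/
def epr : Fin 2 × Fin 2 → ℂ := fun p => if p.1 = p.2 then ((1 / √2 : ℝ) : ℂ) else 0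

/-- `n` copies of a bipartite state vector, the first party holding all the first components. -/
def copies {A B : Type} (ψ : A × B → ℂ) (n : ℕ) : (Fin n → A) × (Fin n → B) → ℂ :=
  fun p => ∏ k, ψ (p.1 k, p.2 k)

/-- `n` copies of a bipartite density matrix, the first party holding all the first components. -/
def copiesDensity {A B : Type} (ρ : Matrix (A × B) (A × B) ℂ) (n : ℕ) :
    Matrix ((Fin n → A) × (Fin n → B)) ((Fin n → A) × (Fin n → B)) ℂ :=
  fun p q => ∏ k, ρ (p.1 k, p.2 k) (q.1 k, q.2 k)

/-- Fidelity `⟨φ|ρ|φ⟩` of a density matrix with a pure state. -/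
def fidelity {A : Type} [Fintype A] (φ : A → ℂ) (ρ : Matrix A A ℂ) : ℝ :=
  (star φ ⬝ᵥ ρ.mulVec φ).re

/-- `R` is an achievable rate of EPR pairs per copy of `ρ`: for `m → ∞`, local operations and
classical communication turn `m` copies of `ρ` into `n m` EPR pairs with fidelity tending to one,
where `n m / m → R`. -/
def IsDistillationRate {A B : Type} [Fintype A] [DecidableEq A] [Fintype B] [DecidableEq B]
    (ρ : Matrix (A × B) (A × B) ℂ) (R : ℝ≥0) : Prop :=
  ∃ (n : ℕ → ℕ)
    (Λ : ∀ m : ℕ, Matrix ((Fin m → A) × (Fin m → B)) ((Fin m → A) × (Fin m → B)) ℂ →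
      Matrix ((Fin (n m) → Fin 2) × (Fin (n m) → Fin 2))
        ((Fin (n m) → Fin 2) × (Fin (n m) → Fin 2)) ℂ),
    (∀ m, IsLOCC (Λ m)) ∧
    Filter.Tendsto (fun m : ℕ => (n m : ℝ) / m) Filter.atTop (nhds (R : ℝ)) ∧
    Filter.Tendsto (fun m : ℕ => fidelity (copies epr (n m)) (Λ m (copiesDensity ρ m)))
      Filter.atTop (nhds 1)

/-- Distillable entanglement: the supremum of the achievable rates. -/
def distillableEntanglement {A B : Type} [Fintype A] [DecidableEq A] [Fintype B] [DecidableEq B]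
    (ρ : Matrix (A × B) (A × B) ℂ) : ℝ≥0∞ :=
  ⨆ (R : ℝ≥0) (_ : IsDistillationRate ρ R), (R : ℝ≥0∞)

/-! ### Fiber -/

/-- Probability that a photon is not absorbed within a fiber of length `l` and attenuation length
`L`: the distance travelled before absorption is exponentially distributed with mean `L`. -/
def fiberTransmission (l L : ℝ) : ℝ≥0∞ := ProbabilityTheory.expMeasure (1 / L) (Set.Ioi l)

end

end QTransduction

/-!
Put `x = γO γM / 4` and `y = N g²`. When both extraction ratios are one, inverting the `2 × 2` drift
matrix gives `|L_OM|² = 4 x y / (x + y)² = η` and `L_MM = (x - y) / (x + y)`, so that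
`|L_MM|² = 1 - η`. The output state is therefore `∑ a, g a |a, σ a⟩` for a bijection `σ`, with
squared Schmidt coefficients `η` and `1 - η`: its reduced states are diagonal with these
eigenvalues.

The heart of the matter is `distillableEntanglement_of_schmidt`: for any state
`∑ a, g a |a, σ a⟩` the distillable entanglement is the Shannon entropy `H` of `p a = |g a|²`.
Copies of such a state are again of this form, indexed by sequences, and by Chebyshev's inequality
almost all the weight lies on at most `2 ^ (m (H + δ))` typical sequences, each of probability at
most `2 ^ (-m (H - δ))`.

* Upper bound. An LOCC operation has product Kraus operators (`IsLOCC.exists_kraus`), and these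
  turn a product state into a maximally entangled state of rank `K` with fidelity at most `1 / K`.
  By the Cauchy-Schwarz inequality a superposition of `D` orthogonal product states reaches at
  most `D / K`, and splitting off the atypical sequences costs their weight and a factor `2`
  (`IsLOCC.fidelity_maxEntangled_le`). For `K = 2 ^ n` with `n / m → R > H` the fidelity tends to
  zero.
* Lower bound. The amplitude of a sequence depends only on its type, the number of occurrences of
  each letter. Each type class is cut into blocks of `K` sequences, and both parties measure in
  which block their sequence lies; a complete block leaves a perfect maximally entangled state of
  rank `K`. What is lost are the atypical sequences and at most one incomplete block for each of
  the polynomially many types (`exists_isLOCC_le_fidelity`), which is negligible for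
  `K = 2 ^ ⌊m R⌋` with `R < H`.

The probability of the three independent events is then the product of this entropy, the
conversion efficiency and the tail of the exponential distribution.
-/

namespace QTransduction

/-! ### Transducers with extraction ratios one -/

namespace Transducer

variable (T : Transducer)

lemma efficiency_nonneg : 0 ≤ T.efficiency := by
  have h1 := T.γeO_nonneg
  have h2 := T.γeM_nonneg
  have h3 := T.N_nonneg
  unfold efficiency
  positivity

lemma det_drift : T.drift.det = ((T.γO * T.γM / 4 + T.coupling ^ 2 : ℝ) : ℂ) := by
  rw [drift, Matrix.det_fin_two_of]
  push_cast
  linear_combination (-(T.coupling : ℂ) ^ 2) * Complex.I_sq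

lemma scattering_zero_one :
    T.scattering 0 1 = (√T.γeO : ℂ) * (Complex.I * T.coupling) * (√T.γeM : ℂ) /
      ((T.γO * T.γM / 4 + T.coupling ^ 2 : ℝ) : ℂ) := by
  rw [scattering, Matrix.inv_def, det_drift, Ring.inverse_eq_inv']
  simp [drift, port, Matrix.adjugate_fin_two_of]
  ring

lemma scattering_one_one :
    T.scattering 1 1 = (√T.γeM : ℂ) * (T.γO / 2) * (√T.γeM : ℂ) /
      ((T.γO * T.γM / 4 + T.coupling ^ 2 : ℝ) : ℂ) - 1 := by
  rw [scattering, Matrix.inv_def, det_drift, Ring.inverse_eq_inv']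
  simp [drift, port, Matrix.adjugate_fin_two_of]
  ring

lemma coupling_sq : T.coupling ^ 2 = T.N * T.g ^ 2 := by
  rw [coupling, mul_pow, Real.sq_sqrt T.N_nonneg, mul_comm]

variable {T}

/-- With `x = γO γM / 4` and `y = N g²` the efficiency is `4 x y / (x + y)²`. -/
lemma one_sub_efficiency (hO : T.extractionO = 1) (hM : T.extractionM = 1) :
    1 - T.efficiency =
      ((T.γO * T.γM / 4 - T.coupling ^ 2) / (T.γO * T.γM / 4 + T.coupling ^ 2)) ^ 2 := by
  have hγO := T.γO_pos
  have hγM := T.γM_pos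
  have hO' : T.γeO = T.γO := (div_eq_one_iff_eq hγO.ne').1 hO
  have hM' : T.γeM = T.γM := (div_eq_one_iff_eq hγM.ne').1 hM
  have hpos : 0 < T.γO * T.γM / 4 + T.coupling ^ 2 := by positivity
  rw [efficiency, hO', hM', sq_abs, ← T.coupling_sq, mul_assoc (T.γO * T.γM), ← T.coupling_sq]
  field_simp
  ring

lemma norm_sq_scattering_zero_one (hO : T.extractionO = 1) (hM : T.extractionM = 1) :
    ‖T.scattering 0 1‖ ^ 2 = T.efficiency := by
  have hγO := T.γO_pos
  have hγM := T.γM_pos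
  have hO' : T.γeO = T.γO := (div_eq_one_iff_eq hγO.ne').1 hO
  have hM' : T.γeM = T.γM := (div_eq_one_iff_eq hγM.ne').1 hM
  rw [scattering_zero_one, efficiency, hO', hM']
  simp only [norm_mul, norm_div, Complex.norm_real, Complex.norm_I, Real.norm_eq_abs, mul_pow,
    div_pow, sq_abs, Real.sq_sqrt hγO.le, Real.sq_sqrt hγM.le, one_mul]
  rw [T.coupling_sq]
  ring

lemma norm_sq_scattering_one_one (hO : T.extractionO = 1) (hM : T.extractionM = 1) :
    ‖T.scattering 1 1‖ ^ 2 = 1 - T.efficiency := by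
  have hγO := T.γO_pos
  have hγM := T.γM_pos
  have hM' : T.γeM = T.γM := (div_eq_one_iff_eq hγM.ne').1 hM
  have hpos : 0 < T.γO * T.γM / 4 + T.coupling ^ 2 := by positivity
  have hreal : T.scattering 1 1 =
      (((T.γO * T.γM / 4 - T.coupling ^ 2) / (T.γO * T.γM / 4 + T.coupling ^ 2) : ℝ) : ℂ) := by
    have hs : (√T.γM : ℂ) * (T.γO / 2) * (√T.γM : ℂ) = ((T.γM * (T.γO / 2) : ℝ) : ℂ) := by
      rw [mul_right_comm, ← Complex.ofReal_mul, Real.mul_self_sqrt hγM.le]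
      push_cast
      ring
    rw [scattering_one_one, hM', hs, ← Complex.ofReal_div, ← Complex.ofReal_one,
      ← Complex.ofReal_sub]
    congr 1
    field_simp
    ring
  rw [hreal, Complex.norm_real, Real.norm_eq_abs, sq_abs, one_sub_efficiency hO hM]

lemma efficiency_le_one (hO : T.extractionO = 1) (hM : T.extractionM = 1) :
    T.efficiency ≤ 1 := by
  have := one_sub_efficiency hO hM
  nlinarith [sq_nonneg ((T.γO * T.γM / 4 - T.coupling ^ 2) /
    (T.γO * T.γM / 4 + T.coupling ^ 2))]

variable (T)

/-- Schmidt coefficients of the output state: the amplitude of the term with `a` microwave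
photons. -/
noncomputable def amplitude : Fin 2 → ℂ := ![T.scattering 0 1, T.scattering 1 1]

/-- The output state is in Schmidt form: exactly one of the two modes holds the photon. -/
lemma outputState_apply (x : Fin 2 × Fin 2) :
    T.outputState x = if x.2 = Fin.revPerm x.1 then T.amplitude x.1 else 0 := by
  obtain ⟨a, b⟩ := x
  fin_cases a <;> fin_cases b <;>
    simp [outputState, amplitude, vacuum, creationO, creationM, creation, Matrix.add_apply]

end Transducer

/-- Every complex number is its modulus times a phase factor (which is `1` at zero). -/
lemma exists_phase (z : ℂ) : ∃ u : ℂ, ‖u‖ = 1 ∧ z = u * (‖z‖ : ℂ) := by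
  by_cases hz : z = 0
  · exact ⟨1, by simp, by simp [hz]⟩
  · have h : ‖z‖ ≠ 0 := by simpa using hz
    refine ⟨z / ‖z‖, by simp [h], ?_⟩
    rw [div_mul_cancel₀]
    exact_mod_cast h

lemma Transducer.outputState_eq_beamSplitter {T : Transducer} (hO : T.extractionO = 1)
    (hM : T.extractionM = 1) :
    ∃ u v : ℂ, ‖u‖ = 1 ∧ ‖v‖ = 1 ∧
      T.outputState =
        (u * (√T.efficiency : ℝ)) • (Pi.single (0, 1) 1 : Fin 2 × Fin 2 → ℂ) +
        (v * (√(1 - T.efficiency) : ℝ)) • (Pi.single (1, 0) 1 : Fin 2 × Fin 2 → ℂ) := by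
  obtain ⟨u, hu, hu'⟩ := exists_phase (T.scattering 0 1)
  obtain ⟨v, hv, hv'⟩ := exists_phase (T.scattering 1 1)
  refine ⟨u, v, hu, hv, ?_⟩
  rw [← norm_sq_scattering_one_one hO hM, ← norm_sq_scattering_zero_one hO hM,
    Real.sqrt_sq (norm_nonneg _), Real.sqrt_sq (norm_nonneg _), ← hu', ← hv']
  ext ⟨a, b⟩
  rw [T.outputState_apply]
  fin_cases a <;> fin_cases b <;> simp [amplitude]

/-! ### Entropy of diagonal states and of states in Schmidt form -/

lemma vonNeumannEntropy_diagonal {A : Type} [Fintype A] [DecidableEq A] (p : A → ℝ) :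
    vonNeumannEntropy (Matrix.diagonal fun a => (p a : ℂ)) = -∑ a, p a * Real.logb 2 (p a) := by
  set D : Matrix A A ℂ := Matrix.diagonal fun a => (p a : ℂ) with hD
  have hsa : IsSelfAdjoint D := by
    rw [IsSelfAdjoint, Matrix.star_eq_conjTranspose, hD, Matrix.diagonal_conjTranspose]
    congr 1
    ext a
    simp
  -- On the finite set of eigenvalues the function is interpolated by a polynomial, for which the
  -- functional calculus of a diagonal matrix is computed entrywise.
  let s : Finset ℝ := (Matrix.finite_real_spectrum (A := D)).toFinset ∪ Finset.univ.image p
  let q : Polynomial ℝ := Lagrange.interpolate s id fun x => x * Real.logb 2 x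
  have hq : ∀ x ∈ s, q.eval x = x * Real.logb 2 x := fun x hx =>
    Lagrange.eval_interpolate_at_node (v := id) _ (Set.injOn_id _) hx
  have hcfc : cfc (fun x : ℝ => x * Real.logb 2 x) D = Polynomial.aeval D q := by
    rw [← cfc_polynomial q D hsa]
    exact cfc_congr fun x hx => (hq x (by simp [s, hx])).symm
  have haeval : Polynomial.aeval D q = Matrix.diagonal fun a => ((q.eval (p a) : ℝ) : ℂ) := by
    have h := Polynomial.aeval_algHom_apply (Matrix.diagonalAlgHom (n := A) (α := ℂ) ℝ)
      (fun a => (p a : ℂ)) q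
    change Polynomial.aeval D q = Matrix.diagonal _ at h
    rw [h]
    congr 1
    ext a
    rw [Polynomial.aeval_pi_apply₂, Polynomial.aeval_def, ← Complex.coe_algebraMap,
      Polynomial.eval₂_at_apply]
  rw [vonNeumannEntropy, hcfc, haeval, Matrix.trace_diagonal, ← Complex.ofReal_sum,
    Complex.ofReal_re]
  congr 1
  exact Finset.sum_congr rfl fun a _ => hq _ (by simp [s])

lemma pureDensity_apply {A : Type} (ψ : A → ℂ) (x y : A) :
    pureDensity ψ x y = ψ x * starRingEnd ℂ (ψ y) := rfl

lemma reducedFst_of_schmidt {A B : Type} [DecidableEq A] [Fintype B] [DecidableEq B]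
    {ψ : A × B → ℂ} {σ : A ≃ B} {g : A → ℂ}
    (hψ : ∀ x, ψ x = if x.2 = σ x.1 then g x.1 else 0) :
    reducedFst (pureDensity ψ) = Matrix.diagonal fun a => ((‖g a‖ ^ 2 : ℝ) : ℂ) := by
  ext i j
  rw [reducedFst, Matrix.diagonal_apply]
  simp only [pureDensity_apply, hψ]
  split_ifs with h
  · subst h
    rw [Finset.sum_eq_single (σ i)]
    · simp [Complex.mul_conj, Complex.normSq_eq_norm_sq]
    · intro b _ hb
      simp [hb]
    · simp
  · refine Finset.sum_eq_zero fun b _ => ?_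
    by_cases hb : b = σ i
    · subst hb
      simp [h]
    · simp [hb]

lemma reducedSnd_of_schmidt {A B : Type} [Fintype A] [DecidableEq B]
    {ψ : A × B → ℂ} {σ : A ≃ B} {g : A → ℂ}
    (hψ : ∀ x, ψ x = if x.2 = σ x.1 then g x.1 else 0) :
    reducedSnd (pureDensity ψ) =
      Matrix.diagonal fun b => ((‖g (σ.symm b)‖ ^ 2 : ℝ) : ℂ) := by
  ext i j
  rw [reducedSnd, Matrix.diagonal_apply]
  simp only [pureDensity_apply, hψ]
  split_ifs with h
  · subst h
    rw [Finset.sum_eq_single (σ.symm i)]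
    · simp [Complex.mul_conj, Complex.normSq_eq_norm_sq]
    · intro a _ ha
      have : i ≠ σ a := fun hi => ha (by simp [hi])
      simp [this]
    · simp
  · refine Finset.sum_eq_zero fun a _ => ?_
    by_cases ha : i = σ a
    · subst ha
      simp [Ne.symm h]
    · simp [ha]

/-! ### Photon loss and independent events -/

lemma toReal_fiberTransmission {l L : ℝ} (hl : 0 ≤ l) (hL : 0 < L) :
    (fiberTransmission l L).toReal = Real.exp (-l / L) := by
  have hr : 0 < 1 / L := by positivity
  have := ProbabilityTheory.isProbabilityMeasure_expMeasure hr
  have h := ProbabilityTheory.cdf_expMeasure_eq hr l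
  rw [ProbabilityTheory.cdf_eq_real, if_pos hl] at h
  have hc := MeasureTheory.probReal_compl_eq_one_sub
    (μ := ProbabilityTheory.expMeasure (1 / L)) (measurableSet_Iic (a := l))
  rw [h, Set.compl_Iic, MeasureTheory.measureReal_def] at hc
  rw [fiberTransmission, hc]
  ring_nf

lemma measureReal_inter_of_iIndepSet {Ω : Type*} [MeasurableSpace Ω]
    {P : MeasureTheory.Measure Ω} {a b c : Set Ω}
    (ha : MeasurableSet a) (hb : MeasurableSet b) (hc : MeasurableSet c)
    (h : ProbabilityTheory.iIndepSet ![a, b, c] P) :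
    P.real (a ∩ b ∩ c) = P.real a * P.real b * P.real c := by
  have h3 := (ProbabilityTheory.iIndepSet_iff_meas_biInter
    (by intro i; fin_cases i <;> simpa)).1 h Finset.univ
  have hi : (⋂ i ∈ (Finset.univ : Finset (Fin 3)), ![a, b, c] i) = a ∩ b ∩ c := by
    ext x
    simp [Fin.forall_fin_succ, and_assoc]
  rw [hi, Fin.prod_univ_three] at h3
  rw [MeasureTheory.measureReal_def, h3]
  simp [MeasureTheory.measureReal_def]

/-! ### Product Kraus form of LOCC operations -/

/-- Every LOCC operation is separable: it has Kraus operators that are products of operators of the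
two parties. -/
lemma IsLOCC.exists_kraus {A B A' B' : Type} [Fintype A] [DecidableEq A] [Fintype B]
    [DecidableEq B] [Fintype A'] [DecidableEq A'] [Fintype B'] [DecidableEq B']
    {Λ : Matrix (A × B) (A × B) ℂ → Matrix (A' × B') (A' × B') ℂ} (h : IsLOCC Λ) :
    ∃ (ι : Type) (_ : Fintype ι) (V : ι → Matrix A' A ℂ) (W : ι → Matrix B' B ℂ),
      ∑ i, (V i ⊗ₖ W i).conjTranspose * (V i ⊗ₖ W i) = 1 ∧
      ∀ ρ, Λ ρ = ∑ i, (V i ⊗ₖ W i) * ρ * (V i ⊗ₖ W i).conjTranspose := by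
  induction h with
  | done => exact ⟨Unit, inferInstance, fun _ => 1, fun _ => 1, by simp, by simp⟩
  | @first A B C κ _ _ _ _ _ _ _ K hK Λ _ ih =>
    choose ι hι V W hVW hΛ using ih
    have hmul : ∀ i j, (V i j * K i) ⊗ₖ W i j = (V i j ⊗ₖ W i j) * (K i ⊗ₖ (1 : Matrix B B ℂ)) :=
      fun i j => by rw [← Matrix.mul_kronecker_mul, Matrix.mul_one]
    refine ⟨Σ i, ι i, inferInstance, fun x => V x.1 x.2 * K x.1, fun x => W x.1 x.2, ?_, ?_⟩
    · simp only [hmul, Fintype.sum_sigma, Matrix.conjTranspose_mul]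
      calc
        _ = ∑ i, (K i ⊗ₖ (1 : Matrix B B ℂ)).conjTranspose *
              (∑ j, (V i j ⊗ₖ W i j).conjTranspose * (V i j ⊗ₖ W i j)) *
                (K i ⊗ₖ (1 : Matrix B B ℂ)) := by
          simp only [Matrix.mul_sum, Matrix.sum_mul, Matrix.mul_assoc]
        _ = (∑ i, (K i).conjTranspose * K i) ⊗ₖ (1 : Matrix B B ℂ) := by
          simp only [hVW, Matrix.mul_one]
          simp only [Matrix.conjTranspose_kronecker, ← Matrix.mul_kronecker_mul,
            Matrix.conjTranspose_one, Matrix.mul_one]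
          ext x y
          simp [Matrix.sum_apply, Finset.sum_mul]
        _ = 1 := by rw [hK, Matrix.one_kronecker_one]
    · intro ρ
      simp only [hmul, Fintype.sum_sigma, Matrix.conjTranspose_mul, hΛ, Matrix.mul_assoc]
  | @second A B C κ _ _ _ _ _ _ _ K hK Λ _ ih =>
    choose ι hι V W hVW hΛ using ih
    have hmul : ∀ i j, V i j ⊗ₖ (W i j * K i) = (V i j ⊗ₖ W i j) * ((1 : Matrix A A ℂ) ⊗ₖ K i) :=
      fun i j => by rw [← Matrix.mul_kronecker_mul, Matrix.mul_one]
    refine ⟨Σ i, ι i, inferInstance, fun x => V x.1 x.2, fun x => W x.1 x.2 * K x.1, ?_, ?_⟩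
    · simp only [hmul, Fintype.sum_sigma, Matrix.conjTranspose_mul]
      calc
        _ = ∑ i, ((1 : Matrix A A ℂ) ⊗ₖ K i).conjTranspose *
              (∑ j, (V i j ⊗ₖ W i j).conjTranspose * (V i j ⊗ₖ W i j)) *
                ((1 : Matrix A A ℂ) ⊗ₖ K i) := by
          simp only [Matrix.mul_sum, Matrix.sum_mul, Matrix.mul_assoc]
        _ = (1 : Matrix A A ℂ) ⊗ₖ (∑ i, (K i).conjTranspose * K i) := by
          simp only [hVW, Matrix.mul_one]
          simp only [Matrix.conjTranspose_kronecker, ← Matrix.mul_kronecker_mul,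
            Matrix.conjTranspose_one, Matrix.mul_one]
          ext x y
          simp [Matrix.sum_apply, Finset.mul_sum]
        _ = 1 := by rw [hK, Matrix.one_kronecker_one]
    · intro ρ
      simp only [hmul, Fintype.sum_sigma, Matrix.conjTranspose_mul, hΛ, Matrix.mul_assoc]

lemma star_dotProduct_self {X : Type} [Fintype X] (v : X → ℂ) :
    star v ⬝ᵥ v = ((∑ x, ‖v x‖ ^ 2 : ℝ) : ℂ) := by
  simp [dotProduct, Complex.conj_mul']

/-- A quantum operation preserves the total probability. -/
lemma sum_norm_sq_mulVec_of_complete {ι X Z : Type} [Fintype ι] [Fintype X] [DecidableEq X]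
    [Fintype Z] {M : ι → Matrix Z X ℂ} (hM : ∑ i, (M i).conjTranspose * M i = 1) (ξ : X → ℂ) :
    ∑ i, ∑ z, ‖(M i).mulVec ξ z‖ ^ 2 = ∑ x, ‖ξ x‖ ^ 2 := by
  apply Complex.ofReal_injective
  rw [← star_dotProduct_self, Complex.ofReal_sum]
  simp only [← star_dotProduct_self, Matrix.star_mulVec]
  calc
    _ = ∑ i, star ξ ⬝ᵥ ((M i).conjTranspose * M i).mulVec ξ := by
      refine Finset.sum_congr rfl fun i _ => ?_
      rw [← Matrix.mulVec_mulVec, Matrix.dotProduct_mulVec (star ξ)]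
    _ = star ξ ⬝ᵥ ξ := by
      rw [← dotProduct_sum, ← Matrix.sum_mulVec, hM, Matrix.one_mulVec]

lemma fidelity_sum {ι X : Type} [Fintype ι] [Fintype X] (φ : X → ℂ) (ρ : ι → Matrix X X ℂ) :
    fidelity φ (∑ i, ρ i) = ∑ i, fidelity φ (ρ i) := by
  simp only [fidelity, Matrix.sum_mulVec, dotProduct_sum, Complex.re_sum]

lemma fidelity_conj_pureDensity {X Z : Type} [Fintype X] [Fintype Z] (φ : Z → ℂ)
    (M : Matrix Z X ℂ) (ξ : X → ℂ) :
    fidelity φ (M * pureDensity ξ * M.conjTranspose) = ‖star φ ⬝ᵥ M.mulVec ξ‖ ^ 2 := by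
  rw [fidelity, pureDensity, Matrix.mul_vecMulVec, Matrix.vecMulVec_mul, ← Matrix.star_mulVec,
    Matrix.vecMulVec_mulVec, dotProduct_smul]
  have : star (M.mulVec ξ) ⬝ᵥ φ = starRingEnd ℂ (star φ ⬝ᵥ M.mulVec ξ) := by
    simp [dotProduct, mul_comm]
  rw [this]
  simp [← Complex.normSq_eq_norm_sq, Complex.normSq_apply]

/-- Cauchy-Schwarz inequality for finite complex vectors. -/
lemma norm_sq_dotProduct_le {X : Type} [Fintype X] (v w : X → ℂ) :
    ‖v ⬝ᵥ w‖ ^ 2 ≤ (∑ x, ‖v x‖ ^ 2) * ∑ x, ‖w x‖ ^ 2 := by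
  calc
    _ ≤ (∑ x, ‖v x‖ * ‖w x‖) ^ 2 := by
      gcongr
      exact (norm_sum_le Finset.univ fun x => v x * w x).trans_eq (by simp only [norm_mul])
    _ ≤ _ := Finset.sum_mul_sq_le_sq_mul_sq _ _ _

/-! ### Maximally entangled states -/

/-- The maximally entangled state `∑ y, |y y⟩ / √|Y|`. -/
noncomputable def maxEntangled (Y : Type) [Fintype Y] [DecidableEq Y] : Y × Y → ℂ :=
  fun p => if p.1 = p.2 then ((1 / √(Fintype.card Y) : ℝ) : ℂ) else 0

lemma copies_epr (n : ℕ) : copies epr n = maxEntangled (Fin n → Fin 2) := by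
  ext ⟨y, z⟩
  simp only [copies, epr, maxEntangled]
  split_ifs with h
  · subst h
    have : √((2 : ℝ) ^ n) = √2 ^ n := by
      rw [Real.sqrt_eq_iff_eq_sq (by positivity) (by positivity), ← pow_mul, mul_comm n 2, pow_mul,
        Real.sq_sqrt (by norm_num)]
    simp [this]
  · obtain ⟨k, hk⟩ := Function.ne_iff.1 h
    exact Finset.prod_eq_zero (Finset.mem_univ k) (by simp [hk])

section MaxEntangled

variable {Y : Type} [Fintype Y] [DecidableEq Y]

lemma star_maxEntangled : star (maxEntangled Y) = maxEntangled Y := by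
  ext p
  simp only [maxEntangled, Pi.star_apply]
  split_ifs <;> simp

lemma maxEntangled_dotProduct (w : Y × Y → ℂ) :
    maxEntangled Y ⬝ᵥ w = ((1 / √(Fintype.card Y) : ℝ) : ℂ) * ∑ y, w (y, y) := by
  simp [dotProduct, maxEntangled, Fintype.sum_prod_type, Finset.mul_sum]

lemma norm_sq_maxEntangled_dotProduct (w : Y × Y → ℂ) :
    ‖maxEntangled Y ⬝ᵥ w‖ ^ 2 = 1 / Fintype.card Y * ‖∑ y, w (y, y)‖ ^ 2 := by
  rw [maxEntangled_dotProduct, norm_mul, mul_pow, Complex.norm_real, Real.norm_eq_abs, sq_abs,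
    div_pow, one_pow, Real.sq_sqrt (by positivity)]

lemma sum_norm_sq_maxEntangled_le : ∑ p, ‖maxEntangled Y p‖ ^ 2 ≤ 1 := by
  have h2 := star_dotProduct_self (maxEntangled Y)
  rw [star_maxEntangled, maxEntangled_dotProduct] at h2
  have h3 : ∑ p, ‖maxEntangled Y p‖ ^ 2 = 1 / √(Fintype.card Y) *
      (Fintype.card Y * (1 / √(Fintype.card Y))) := by
    apply Complex.ofReal_injective
    rw [← h2]
    simp [maxEntangled]
  rw [h3, ← mul_assoc, mul_right_comm, div_mul_div_comm, one_mul,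
    Real.mul_self_sqrt (by positivity), one_div]
  exact inv_mul_le_one

end MaxEntangled

/-! ### Upper bounds on the fidelity reached by LOCC operations -/

section Converse

variable {A B Y : Type} [Fintype A] [DecidableEq A] [Fintype B] [DecidableEq B] [Fintype Y]
  [DecidableEq Y] {ι : Type} [Fintype ι] {V : ι → Matrix Y A ℂ} {W : ι → Matrix Y B ℂ}

lemma sum_norm_sq_overlap_le
    (h : ∑ i, (V i ⊗ₖ W i).conjTranspose * (V i ⊗ₖ W i) = 1) (ξ : A × B → ℂ) :
    ∑ i, ‖maxEntangled Y ⬝ᵥ (V i ⊗ₖ W i).mulVec ξ‖ ^ 2 ≤ ∑ x, ‖ξ x‖ ^ 2 := by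
  rw [← sum_norm_sq_mulVec_of_complete h ξ]
  refine Finset.sum_le_sum fun i _ => (norm_sq_dotProduct_le _ _).trans ?_
  exact mul_le_of_le_one_left (by positivity) sum_norm_sq_maxEntangled_le

/-- A product state can be turned into a maximally entangled state of rank `K` with fidelity at
most `1 / K`. -/
lemma sum_norm_sq_overlap_single_le
    (h : ∑ i, (V i ⊗ₖ W i).conjTranspose * (V i ⊗ₖ W i) = 1) (a : A) (b : B) :
    ∑ i, ‖maxEntangled Y ⬝ᵥ (V i ⊗ₖ W i).mulVec (Pi.single (a, b) 1)‖ ^ 2 ≤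
      1 / Fintype.card Y := by
  have hone : ∑ i, ∑ z, ‖(V i ⊗ₖ W i).mulVec (Pi.single (a, b) 1) z‖ ^ 2 = 1 := by
    rw [sum_norm_sq_mulVec_of_complete h, Finset.sum_eq_single (a, b)]
    · simp
    · intro x _ hx
      simp [hx]
    · simp
  calc
    _ ≤ ∑ i, 1 / (Fintype.card Y : ℝ) *
          ∑ z, ‖(V i ⊗ₖ W i).mulVec (Pi.single (a, b) 1) z‖ ^ 2 := by
      refine Finset.sum_le_sum fun i _ => ?_
      rw [norm_sq_maxEntangled_dotProduct]
      gcongr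
      refine (norm_sq_dotProduct_le (fun y => V i y a) (fun y => W i y b)
        |>.trans_eq' ?_).trans_eq ?_
      · simp [dotProduct]
      · simp [Fintype.sum_prod_type, Finset.sum_mul_sum, mul_pow]
    _ = _ := by rw [← Finset.mul_sum, hone, mul_one]

/-- If a state in Schmidt form is turned into a maximally entangled state of rank `K`, the terms
in a set `T` contribute at most of the order `|T| / K` to the fidelity, and the other terms at most
of the order of their weight. -/
lemma IsLOCC.fidelity_maxEntangled_le {Λ : Matrix (A × B) (A × B) ℂ → Matrix (Y × Y) (Y × Y) ℂ}
    (hΛ : IsLOCC Λ) {ψ : A × B → ℂ} {σ : A ≃ B} {g : A → ℂ}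
    (hψ : ∀ x, ψ x = if x.2 = σ x.1 then g x.1 else 0) (hg : ∑ a, ‖g a‖ ^ 2 = 1)
    (T : Finset A) :
    fidelity (maxEntangled Y) (Λ (pureDensity ψ)) ≤
      2 * (T.card / Fintype.card Y + ∑ a ∈ Tᶜ, ‖g a‖ ^ 2) := by
  obtain ⟨ι, _, V, W, hVW, hΛ⟩ := hΛ.exists_kraus
  let u : ι → (A × B → ℂ) → ℂ := fun i ξ => maxEntangled Y ⬝ᵥ (V i ⊗ₖ W i).mulVec ξ
  let ψ₁ : A × B → ℂ := ∑ a ∈ T, g a • Pi.single (a, σ a) 1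
  let ψ₂ : A × B → ℂ := fun x => if x.2 = σ x.1 ∧ x.1 ∉ T then g x.1 else 0
  have hsplit : ψ = ψ₁ + ψ₂ := by
    ext ⟨a, b⟩
    have h1 : ψ₁ (a, b) = if b = σ a ∧ a ∈ T then g a else 0 := by
      simp only [ψ₁, Finset.sum_apply, Pi.smul_apply, Pi.single_apply, Prod.mk.injEq, smul_eq_mul,
        mul_ite, mul_one, mul_zero]
      split_ifs with hc
      · rw [Finset.sum_eq_single_of_mem a hc.2]
        · simp [hc.1]
        · intro c _ hca
          simp [Ne.symm hca]
      · refine Finset.sum_eq_zero fun c hcT => if_neg ?_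
        rintro ⟨rfl, rfl⟩
        exact hc ⟨rfl, hcT⟩
    rw [Pi.add_apply, h1, hψ]
    by_cases hb : b = σ a <;> by_cases ha : a ∈ T <;> simp [ψ₂, hb, ha]
  have hF : fidelity (maxEntangled Y) (Λ (pureDensity ψ)) = ∑ i, ‖u i ψ‖ ^ 2 := by
    rw [hΛ, fidelity_sum]
    simp only [fidelity_conj_pureDensity, star_maxEntangled, u]
  have h₁ : ∑ i, ‖u i ψ₁‖ ^ 2 ≤ T.card / Fintype.card Y := by
    have hlin : ∀ i, u i ψ₁ = ∑ a ∈ T, g a * u i (Pi.single (a, σ a) 1) := fun i => by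
      simp only [u, ψ₁, Matrix.mulVec_sum, Matrix.mulVec_smul, dotProduct_sum, dotProduct_smul,
        smul_eq_mul]
    have hgT : ∑ a ∈ T, ‖g a‖ ^ 2 ≤ 1 :=
      hg ▸ Finset.sum_le_univ_sum_of_nonneg fun a => by positivity
    calc
      _ ≤ ∑ i, ∑ a ∈ T, ‖u i (Pi.single (a, σ a) 1)‖ ^ 2 := by
        refine Finset.sum_le_sum fun i _ => ?_
        rw [hlin]
        calc
          _ ≤ (∑ a ∈ T, ‖g a‖ * ‖u i (Pi.single (a, σ a) 1)‖) ^ 2 := by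
            gcongr
            simpa only [norm_mul] using
              norm_sum_le T fun a => g a * u i (Pi.single (a, σ a) 1)
          _ ≤ (∑ a ∈ T, ‖g a‖ ^ 2) * ∑ a ∈ T, ‖u i (Pi.single (a, σ a) 1)‖ ^ 2 :=
            Finset.sum_mul_sq_le_sq_mul_sq _ _ _
          _ ≤ _ := mul_le_of_le_one_left (by positivity) hgT
      _ = ∑ a ∈ T, ∑ i, ‖u i (Pi.single (a, σ a) 1)‖ ^ 2 := Finset.sum_comm
      _ ≤ ∑ a ∈ T, 1 / (Fintype.card Y : ℝ) :=
        Finset.sum_le_sum fun a _ => sum_norm_sq_overlap_single_le hVW a (σ a)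
      _ = _ := by rw [Finset.sum_const, nsmul_eq_mul, mul_one_div]
  have h₂ : ∑ i, ‖u i ψ₂‖ ^ 2 ≤ ∑ a ∈ Tᶜ, ‖g a‖ ^ 2 := by
    refine (sum_norm_sq_overlap_le hVW ψ₂).trans_eq ?_
    rw [Fintype.sum_prod_type, Finset.compl_eq_univ_sdiff, ← Finset.filter_notMem_eq_sdiff,
      Finset.sum_filter]
    refine Finset.sum_congr rfl fun a _ => ?_
    rw [Finset.sum_eq_single (σ a)]
    · by_cases ha : a ∈ T <;> simp [ψ₂, ha]
    · intro b _ hb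
      simp [ψ₂, hb]
    · simp
  calc
    _ = ∑ i, ‖u i ψ₁ + u i ψ₂‖ ^ 2 := by
      rw [hF]
      refine Finset.sum_congr rfl fun i _ => ?_
      simp only [u, hsplit, Matrix.mulVec_add, dotProduct_add]
    _ ≤ ∑ i, 2 * (‖u i ψ₁‖ ^ 2 + ‖u i ψ₂‖ ^ 2) := by
      refine Finset.sum_le_sum fun i _ => ?_
      calc
        _ ≤ (‖u i ψ₁‖ + ‖u i ψ₂‖) ^ 2 := by
          gcongr
          exact norm_add_le _ _
        _ ≤ _ := add_sq_le
    _ ≤ _ := by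
      rw [← Finset.mul_sum, Finset.sum_add_distrib]
      gcongr

lemma IsLOCC.fidelity_maxEntangled_le_one
    {Λ : Matrix (A × B) (A × B) ℂ → Matrix (Y × Y) (Y × Y) ℂ}
    (hΛ : IsLOCC Λ) {ψ : A × B → ℂ} (hψ : ∑ x, ‖ψ x‖ ^ 2 = 1) :
    fidelity (maxEntangled Y) (Λ (pureDensity ψ)) ≤ 1 := by
  obtain ⟨ι, _, V, W, hVW, hΛ⟩ := hΛ.exists_kraus
  rw [hΛ, fidelity_sum, ← hψ]
  simp only [fidelity_conj_pureDensity, star_maxEntangled]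
  exact sum_norm_sq_overlap_le hVW ψ

end Converse

/-! ### Typical sequences -/

section Typical

variable {A : Type} [Fintype A]

/-- Shannon entropy, in bits, of the distribution `p`. -/
noncomputable def shannonEntropy (p : A → ℝ) : ℝ := -∑ a, p a * Real.logb 2 (p a)

lemma sum_seq_succ {m : ℕ} (F : (Fin (m + 1) → A) → ℝ) :
    ∑ x, F x = ∑ a, ∑ y : Fin m → A, F (Fin.cons a y) := by
  rw [← Fintype.sum_prod_type']
  exact (Fintype.sum_equiv (Fin.consEquiv fun _ => A) _ _ fun _ => rfl).symm

lemma sum_prod_seq {p : A → ℝ} (hp : ∑ a, p a = 1) (m : ℕ) :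
    ∑ x : Fin m → A, ∏ k, p (x k) = 1 := by
  induction m with
  | zero => simp
  | succ m ih =>
    simp only [sum_seq_succ, Fin.prod_univ_succ, Fin.cons_zero, Fin.cons_succ, ← Finset.mul_sum,
      ih, mul_one, hp]

lemma sum_prod_seq_mul_sum {p f : A → ℝ} (hp : ∑ a, p a = 1) (hf : ∑ a, p a * f a = 0) (m : ℕ) :
    ∑ x : Fin m → A, (∏ k, p (x k)) * ∑ k, f (x k) = 0 := by
  induction m with
  | zero => simp
  | succ m ih =>
    simp only [sum_seq_succ, Fin.prod_univ_succ, Fin.sum_univ_succ, Fin.cons_zero, Fin.cons_succ]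
    calc
      _ = ∑ a, (p a * f a * (∑ y : Fin m → A, ∏ k, p (y k)) +
            p a * ∑ y : Fin m → A, (∏ k, p (y k)) * ∑ k, f (y k)) := by
        refine Finset.sum_congr rfl fun a _ => ?_
        simp only [Finset.mul_sum (s := (Finset.univ : Finset (Fin m → A))),
          ← Finset.sum_add_distrib]
        exact Finset.sum_congr rfl fun y _ => by ring
      _ = 0 := by simp [ih, sum_prod_seq hp, hf]

/-- The variance of a sum of independent centered random variables. -/
lemma sum_prod_seq_mul_sum_sq {p f : A → ℝ} (hp : ∑ a, p a = 1) (hf : ∑ a, p a * f a = 0)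
    (m : ℕ) :
    ∑ x : Fin m → A, (∏ k, p (x k)) * (∑ k, f (x k)) ^ 2 = m * ∑ a, p a * f a ^ 2 := by
  induction m with
  | zero => simp
  | succ m ih =>
    simp only [sum_seq_succ, Fin.prod_univ_succ, Fin.sum_univ_succ, Fin.cons_zero, Fin.cons_succ]
    calc
      _ = ∑ a, (p a * f a ^ 2 * (∑ y : Fin m → A, ∏ k, p (y k)) +
            2 * (p a * f a) * (∑ y : Fin m → A, (∏ k, p (y k)) * ∑ k, f (y k)) +
            p a * ∑ y : Fin m → A, (∏ k, p (y k)) * (∑ k, f (y k)) ^ 2) := by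
        refine Finset.sum_congr rfl fun a _ => ?_
        simp only [Finset.mul_sum (s := (Finset.univ : Finset (Fin m → A))),
          ← Finset.sum_add_distrib]
        exact Finset.sum_congr rfl fun y _ => by ring
      _ = _ := by
        simp only [ih, sum_prod_seq hp, sum_prod_seq_mul_sum hp hf, mul_one, mul_zero, add_zero,
          Finset.sum_add_distrib, ← Finset.sum_mul, hp]
        push_cast
        ring

/-- The sequences of length `m` whose probability is positive and differs from `2 ^ (-m H)` by a
factor of at most `2 ^ (m δ)`, where `H` is the entropy of `p`. -/
noncomputable def typicalSet (p : A → ℝ) (δ : ℝ) (m : ℕ) : Finset (Fin m → A) :=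
  {x | 0 < ∏ k, p (x k) ∧ |Real.logb 2 (∏ k, p (x k)) + m * shannonEntropy p| ≤ m * δ}

variable {p : A → ℝ} {δ : ℝ} {m : ℕ}

lemma prod_le_of_mem_typicalSet {x : Fin m → A} (hx : x ∈ typicalSet p δ m) :
    ∏ k, p (x k) ≤ 2 ^ (-(m * (shannonEntropy p - δ))) := by
  simp only [typicalSet, Finset.mem_filter_univ] at hx
  rw [← Real.logb_le_iff_le_rpow one_lt_two hx.1]
  linarith [(abs_le.1 hx.2).2]

lemma le_prod_of_mem_typicalSet {x : Fin m → A} (hx : x ∈ typicalSet p δ m) :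
    2 ^ (-(m * (shannonEntropy p + δ))) ≤ ∏ k, p (x k) := by
  simp only [typicalSet, Finset.mem_filter_univ] at hx
  rw [← Real.le_logb_iff_rpow_le one_lt_two hx.1]
  linarith [(abs_le.1 hx.2).1]

lemma card_typicalSet_le (hp0 : ∀ a, 0 ≤ p a) (hp : ∑ a, p a = 1) :
    ((typicalSet p δ m).card : ℝ) ≤ 2 ^ (m * (shannonEntropy p + δ)) := by
  have h : ((typicalSet p δ m).card : ℝ) * 2 ^ (-(m * (shannonEntropy p + δ))) ≤ 1 := by
    calc
      _ = ∑ x ∈ typicalSet p δ m, (2 : ℝ) ^ (-(m * (shannonEntropy p + δ))) := by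
        rw [Finset.sum_const, nsmul_eq_mul]
      _ ≤ ∑ x ∈ typicalSet p δ m, ∏ k, p (x k) :=
        Finset.sum_le_sum fun x hx => le_prod_of_mem_typicalSet hx
      _ ≤ ∑ x : Fin m → A, ∏ k, p (x k) :=
        Finset.sum_le_univ_sum_of_nonneg fun x => Finset.prod_nonneg fun k _ => hp0 _
      _ = 1 := sum_prod_seq hp m
  rwa [Real.rpow_neg zero_le_two, ← div_eq_mul_inv, div_le_one (by positivity)] at h

/-- Chebyshev's inequality for the surprisal `-log₂ p`. -/
lemma sum_compl_typicalSet_le [DecidableEq A] (hp0 : ∀ a, 0 ≤ p a) (hp : ∑ a, p a = 1) (hδ : 0 < δ)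
    (hm : m ≠ 0) :
    ∑ x ∈ (typicalSet p δ m)ᶜ, ∏ k, p (x k) ≤
      (∑ a, p a * (Real.logb 2 (p a) + shannonEntropy p) ^ 2) / δ ^ 2 / m := by
  have hm' : (0 : ℝ) < m := by positivity
  set f : A → ℝ := fun a => Real.logb 2 (p a) + shannonEntropy p with hf
  have hf0 : ∑ a, p a * f a = 0 := by
    simp only [hf, mul_add, Finset.sum_add_distrib, ← Finset.sum_mul, hp, shannonEntropy]
    ring
  have hw0 : ∀ x : Fin m → A, 0 ≤ ∏ k, p (x k) := fun x => Finset.prod_nonneg fun k _ => hp0 _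
  have key : (∑ x ∈ (typicalSet p δ m)ᶜ, ∏ k, p (x k)) * (m * δ) ^ 2 ≤
      m * ∑ a, p a * f a ^ 2 := by
    rw [← sum_prod_seq_mul_sum_sq hp hf0, Finset.sum_mul]
    refine (Finset.sum_le_sum fun x hx => ?_).trans
      (Finset.sum_le_univ_sum_of_nonneg fun x => mul_nonneg (hw0 x) (sq_nonneg _))
    rcases (hw0 x).eq_or_lt with h0 | hpos
    · rw [← h0, zero_mul, zero_mul]
    · refine mul_le_mul_of_nonneg_left ?_ hpos.le
      have hsum : ∑ k, f (x k) = Real.logb 2 (∏ k, p (x k)) + m * shannonEntropy p := by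
        rw [Real.logb_prod _ _ fun k hk => (Finset.prod_ne_zero_iff.1 hpos.ne') k hk]
        simp [hf, Finset.sum_add_distrib]
      simp only [typicalSet, Finset.mem_compl, Finset.mem_filter_univ, not_and, not_le] at hx
      rw [hsum, sq_le_sq, abs_of_pos (by positivity : 0 < (m : ℝ) * δ)]
      exact (hx hpos).le
  rw [div_div, le_div_iff₀ (by positivity)]
  nlinarith

/-- Asymptotic equipartition: in the limit only the typical sequences matter. -/
lemma tendsto_sum_compl_typicalSet [DecidableEq A] (hp0 : ∀ a, 0 ≤ p a) (hp : ∑ a, p a = 1)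
    (hδ : 0 < δ) :
    Filter.Tendsto (fun m : ℕ => ∑ x ∈ (typicalSet p δ m)ᶜ, ∏ k, p (x k)) Filter.atTop
      (nhds 0) := by
  refine squeeze_zero' (.of_forall fun m => Finset.sum_nonneg fun x _ =>
    Finset.prod_nonneg fun k _ => hp0 _) ?_ (tendsto_const_div_atTop_nhds_zero_nat
      ((∑ a, p a * (Real.logb 2 (p a) + shannonEntropy p) ^ 2) / δ ^ 2))
  filter_upwards [Filter.eventually_ne_atTop 0] with m hm
  exact sum_compl_typicalSet_le hp0 hp hδ hm

end Typical

/-! ### Entanglement concentration -/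

/-- Kraus operators of the projective measurement of the first component of an injective label
`f`; the second component, which stays in superposition, becomes the new basis. -/
def labelKraus {X I Y : Type} [DecidableEq I] [DecidableEq Y] (f : X → I × Y) (i : I) :
    Matrix Y X ℂ :=
  Matrix.of fun y x => if f x = (i, y) then 1 else 0

lemma labelKraus_complete {X I Y : Type} [DecidableEq X] [Fintype I] [DecidableEq I]
    [Fintype Y] [DecidableEq Y] {f : X → I × Y} (hf : Function.Injective f) :
    ∑ i, (labelKraus f i).conjTranspose * labelKraus f i = 1 := by
  ext x x'
  simp only [Matrix.sum_apply, Matrix.mul_apply, Matrix.conjTranspose_apply, labelKraus,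
    Matrix.of_apply]
  rw [← Fintype.sum_prod_type' fun i y =>
    star (if f x = (i, y) then (1 : ℂ) else 0) * if f x' = (i, y) then 1 else 0]
  rw [Finset.sum_eq_single (f x)]
  · simp [Matrix.one_apply, hf.eq_iff, eq_comm]
  · rintro ⟨i, y⟩ _ h
    simp [Ne.symm h]
  · simp

/-- A finite set that is partitioned into classes `t ⁻¹ {s}` can be labelled injectively so that
each class `s` is cut into `|t ⁻¹ {s}| / |Y|` complete blocks, indexed by `Y`, and a remainder. -/
lemma exists_blockLabel {X T : Type} [Fintype X] [DecidableEq T] (Y : Type) [Fintype Y]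
    [Nonempty Y] (t : X → T) :
    ∃ f : X → (T × Fin (Fintype.card X)) × Y, Function.Injective f ∧
      (∀ x, (f x).1.1 = t x) ∧ ∀ (s : T) (q : Fin (Fintype.card X)) (y : Y),
        (q : ℕ) < Fintype.card {x // t x = s} / Fintype.card Y → ∃ x, f x = ((s, q), y) := by
  have hK : 0 < Fintype.card Y := Fintype.card_pos
  let e := fun s => Fintype.equivFin {x // t x = s}
  let eY := Fintype.equivFin Y
  let r : X → ℕ := fun x => e (t x) ⟨x, rfl⟩
  have hr : ∀ x s (h : t x = s), r x = e s ⟨x, h⟩ := by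
    rintro x _ rfl
    rfl
  have hlt : ∀ x, r x < Fintype.card X := fun x =>
    (e (t x) ⟨x, rfl⟩).2.trans_le (Fintype.card_subtype_le _)
  refine ⟨fun x => ((t x, ⟨r x / Fintype.card Y, (Nat.div_le_self _ _).trans_lt (hlt x)⟩),
    eY.symm ⟨r x % Fintype.card Y, Nat.mod_lt _ hK⟩), ?_, fun _ => rfl, ?_⟩
  · intro x x' h
    simp only [Prod.mk.injEq, Fin.mk.injEq, EmbeddingLike.apply_eq_iff_eq] at h
    obtain ⟨⟨ht, hdiv⟩, hmod⟩ := h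
    have hrr : r x = r x' := by
      rw [← Nat.div_add_mod (r x) (Fintype.card Y), hdiv, hmod, Nat.div_add_mod]
    rw [hr x _ ht, hr x' _ rfl] at hrr
    simpa using (e (t x')).injective (Fin.ext hrr)
  · intro s q y hq
    have hlt' : q * Fintype.card Y + eY y < Fintype.card {x // t x = s} := by
      have h1 := (Nat.le_div_iff_mul_le hK).1 (Nat.succ_le_of_lt hq)
      have h2 := (eY y).2
      rw [Nat.succ_mul] at h1
      omega
    let z := (e s).symm ⟨_, hlt'⟩
    have hz : r z = q * Fintype.card Y + eY y := by
      rw [hr z s z.2]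
      simp [z]
    refine ⟨z, ?_⟩
    have hdiv : r z / Fintype.card Y = q := by
      rw [hz, mul_comm, Nat.mul_add_div hK, Nat.div_eq_of_lt (eY y).2, add_zero]
    have hmod : r z % Fintype.card Y = eY y := by
      rw [hz, mul_comm, Nat.mul_add_mod, Nat.mod_eq_of_lt (eY y).2]
    simp only [hdiv, hmod, z.2, Fin.eta, Equiv.symm_apply_apply]

section Concentration

variable {X X' Y : Type} [Fintype X] [DecidableEq X] [Fintype X'] [DecidableEq X'] [Fintype Y]
  [DecidableEq Y] {ψ : X × X' → ℂ} {σ : X ≃ X'} {c : X → ℂ}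

/-- The measurement of a label by both parties collects the amplitudes of the basis states with
equal first label component into one maximally entangled state. -/
lemma exists_isLOCC_fidelity_label {I : Type} [Fintype I] [DecidableEq I]
    (hψ : ∀ x, ψ x = if x.2 = σ x.1 then c x.1 else 0)
    {f : X → I × Y} (hf : Function.Injective f) :
    ∃ Λ : Matrix (X × X') (X × X') ℂ → Matrix (Y × Y) (Y × Y) ℂ, IsLOCC Λ ∧
      1 / Fintype.card Y * ∑ i, ‖∑ x with (f x).1 = i, c x‖ ^ 2 ≤
        fidelity (maxEntangled Y) (Λ (pureDensity ψ)) := by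
  let f' : X' → I × Y := f ∘ σ.symm
  have hf' : Function.Injective f' := hf.comp σ.symm.injective
  refine ⟨_, IsLOCC.first (labelKraus f) (labelKraus_complete hf) _ fun _ =>
    IsLOCC.second (labelKraus f') (labelKraus_complete hf') _ fun _ => IsLOCC.done, ?_⟩
  have hM : ∀ (i j : I) (ρ : Matrix (X × X') (X × X') ℂ),
      ((1 : Matrix Y Y ℂ) ⊗ₖ labelKraus f' j) *
        ((labelKraus f i ⊗ₖ (1 : Matrix X' X' ℂ)) * ρ *
          (labelKraus f i ⊗ₖ (1 : Matrix X' X' ℂ)).conjTranspose) *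
        ((1 : Matrix Y Y ℂ) ⊗ₖ labelKraus f' j).conjTranspose =
      (labelKraus f i ⊗ₖ labelKraus f' j) * ρ *
        (labelKraus f i ⊗ₖ labelKraus f' j).conjTranspose := by
    intro i j ρ
    have h : labelKraus f i ⊗ₖ labelKraus f' j = ((1 : Matrix Y Y ℂ) ⊗ₖ labelKraus f' j) *
        (labelKraus f i ⊗ₖ (1 : Matrix X' X' ℂ)) := by
      rw [← Matrix.mul_kronecker_mul, Matrix.one_mul, Matrix.mul_one]
    rw [h, Matrix.conjTranspose_mul]
    simp only [Matrix.mul_assoc]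
  simp only [hM, fidelity_sum, fidelity_conj_pureDensity, star_maxEntangled]
  rw [Finset.mul_sum]
  refine Finset.sum_le_sum fun i _ => ?_
  -- The two outcomes always agree, so that only the terms with equal outcomes matter.
  refine le_trans (le_of_eq ?_) (Finset.single_le_sum
    (f := fun j => ‖maxEntangled Y ⬝ᵥ (labelKraus f i ⊗ₖ labelKraus f' j).mulVec ψ‖ ^ 2)
    (fun j _ => sq_nonneg _) (Finset.mem_univ i))
  rw [norm_sq_maxEntangled_dotProduct]
  congr 3
  have hy : ∀ y, (labelKraus f i ⊗ₖ labelKraus f' i).mulVec ψ (y, y) =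
      ∑ x, if f x = (i, y) then c x else 0 := by
    intro y
    simp only [Matrix.mulVec, dotProduct, Fintype.sum_prod_type, Matrix.kroneckerMap_apply, hψ]
    refine Finset.sum_congr rfl fun x _ => ?_
    rw [Finset.sum_eq_single (σ x)]
    · by_cases h : f x = (i, y) <;> simp [labelKraus, f', h]
    · intro x' _ hx'
      simp [hx']
    · simp
  simp only [hy]
  rw [Finset.sum_comm, Finset.sum_filter]
  refine Finset.sum_congr rfl fun x _ => ?_
  rw [Finset.sum_eq_single (f x).2]
  · simp [Prod.ext_iff]
  · intro y _ hy
    simp [Prod.ext_iff, Ne.symm hy]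
  · simp

variable {T : Type} [Fintype T] [DecidableEq T]

/-- If the amplitudes of a state in Schmidt form depend only on a class `t x`, all complete blocks
of equal amplitudes contribute to the fidelity with which a maximally entangled state of rank
`|Y|` can be produced. -/
lemma exists_isLOCC_fidelity_blocks [Nonempty Y]
    (hψ : ∀ x, ψ x = if x.2 = σ x.1 then c x.1 else 0) {t : X → T} {c₀ : T → ℂ}
    (hc : ∀ x, c x = c₀ (t x)) :
    ∃ Λ : Matrix (X × X') (X × X') ℂ → Matrix (Y × Y) (Y × Y) ℂ, IsLOCC Λ ∧
      ∑ s, ((Fintype.card {x // t x = s} / Fintype.card Y : ℕ) : ℝ) *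
          (Fintype.card Y * ‖c₀ s‖ ^ 2) ≤
        fidelity (maxEntangled Y) (Λ (pureDensity ψ)) := by
  obtain ⟨f, hf, hft, hsurj⟩ := exists_blockLabel Y t
  obtain ⟨Λ, hΛ, hF⟩ := exists_isLOCC_fidelity_label hψ hf
  have hK : (0 : ℝ) < Fintype.card Y := by exact_mod_cast Fintype.card_pos
  refine ⟨Λ, hΛ, le_trans ?_ hF⟩
  rw [Finset.mul_sum, Fintype.sum_prod_type]
  refine Finset.sum_le_sum fun s _ => ?_
  set n := Fintype.card {x // t x = s} / Fintype.card Y with hn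
  have hblock : ∀ q : Fin (Fintype.card X), (q : ℕ) < n →
      1 / (Fintype.card Y : ℝ) * ‖∑ x with (f x).1 = (s, q), c x‖ ^ 2 =
        Fintype.card Y * ‖c₀ s‖ ^ 2 := by
    intro q hq
    choose b hb using fun y => hsurj s q y hq
    have hsum : ∑ x with (f x).1 = (s, q), c x = ∑ y, c (b y) := by
      symm
      refine Finset.sum_bij (fun y _ => b y) (fun y _ => by simp [hb]) ?_ ?_ fun _ _ => rfl
      · intro y _ y' _ h
        have := congrArg f h
        simpa [hb] using this
      · intro x hx
        refine ⟨(f x).2, Finset.mem_univ _, hf ?_⟩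
        rw [hb, ← (Finset.mem_filter_univ x).1 hx]
    have hcb : ∀ y, c (b y) = c₀ s := by
      intro y
      rw [hc, ← hft, hb]
    rw [hsum]
    simp only [hcb, Finset.sum_const, Finset.card_univ, nsmul_eq_mul, norm_mul,
      Complex.norm_natCast]
    field_simp
  have hcard : (Finset.univ.filter fun q : Fin (Fintype.card X) => (q : ℕ) < n).card = n := by
    rw [Fin.card_filter_val_lt, min_eq_right]
    exact (Nat.div_le_self _ _).trans (Fintype.card_subtype_le _)
  calc
    _ = ∑ q ∈ Finset.univ.filter fun q : Fin (Fintype.card X) => (q : ℕ) < n,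
          (Fintype.card Y * ‖c₀ s‖ ^ 2 : ℝ) := by
      rw [Finset.sum_const, hcard, nsmul_eq_mul]
    _ = ∑ q ∈ Finset.univ.filter fun q : Fin (Fintype.card X) => (q : ℕ) < n,
          1 / (Fintype.card Y : ℝ) * ‖∑ x with (f x).1 = (s, q), c x‖ ^ 2 :=
      Finset.sum_congr rfl fun q hq => (hblock q ((Finset.mem_filter_univ q).1 hq)).symm
    _ ≤ _ := Finset.sum_le_univ_sum_of_nonneg fun q => by positivity

/-- Fidelity of entanglement concentration: what is lost are the incomplete blocks, of which there
is one for each class, and the terms outside a set `G` of small amplitudes. -/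
lemma exists_isLOCC_le_fidelity [Nonempty Y]
    (hψ : ∀ x, ψ x = if x.2 = σ x.1 then c x.1 else 0) (hc1 : ∑ x, ‖c x‖ ^ 2 = 1)
    {t : X → T} {c₀ : T → ℂ} (hc : ∀ x, c x = c₀ (t x)) {G : Finset X} {τ : ℝ} (hτ : 0 ≤ τ)
    (hG : ∀ x ∈ G, ‖c x‖ ^ 2 ≤ τ) :
    ∃ Λ : Matrix (X × X') (X × X') ℂ → Matrix (Y × Y) (Y × Y) ℂ, IsLOCC Λ ∧
      1 - (∑ x ∈ Gᶜ, ‖c x‖ ^ 2 + Fintype.card T * (Fintype.card Y * τ)) ≤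
        fidelity (maxEntangled Y) (Λ (pureDensity ψ)) := by
  obtain ⟨Λ, hΛ, hF⟩ := exists_isLOCC_fidelity_blocks (Y := Y) hψ hc
  refine ⟨Λ, hΛ, le_trans ?_ hF⟩
  have hK : 0 < Fintype.card Y := Fintype.card_pos
  have hclass : ∀ s, ∑ x with t x = s, ‖c x‖ ^ 2 =
      Fintype.card {x // t x = s} * ‖c₀ s‖ ^ 2 := by
    intro s
    rw [Finset.sum_congr rfl fun x hx => by rw [hc, (Finset.mem_filter_univ x).1 hx],
      Finset.sum_const, nsmul_eq_mul, Fintype.card_subtype]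
  have hs : ∀ s, Fintype.card {x // t x = s} * ‖c₀ s‖ ^ 2 -
        (∑ x ∈ Gᶜ with t x = s, ‖c x‖ ^ 2 + Fintype.card Y * τ) ≤
      ((Fintype.card {x // t x = s} / Fintype.card Y : ℕ) : ℝ) *
        (Fintype.card Y * ‖c₀ s‖ ^ 2) := by
    intro s
    have hdm : (Fintype.card {x // t x = s} : ℝ) =
        Fintype.card Y * ((Fintype.card {x // t x = s} / Fintype.card Y : ℕ) : ℝ) +
          ((Fintype.card {x // t x = s} % Fintype.card Y : ℕ) : ℝ) := by
      exact_mod_cast (Nat.div_add_mod _ _).symm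
    have hsplit : ((Fintype.card {x // t x = s} % Fintype.card Y : ℕ) : ℝ) * ‖c₀ s‖ ^ 2 ≤
        ∑ x ∈ Gᶜ with t x = s, ‖c x‖ ^ 2 + Fintype.card Y * τ := by
      by_cases h : ∃ x ∈ G, t x = s
      · obtain ⟨x, hx, rfl⟩ := h
        have h1 : ‖c₀ (t x)‖ ^ 2 ≤ τ := hc x ▸ hG x hx
        have h2 : ((Fintype.card {x' // t x' = t x} % Fintype.card Y : ℕ) : ℝ) ≤
            Fintype.card Y := by exact_mod_cast (Nat.mod_lt _ hK).le
        have h3 : 0 ≤ ∑ x' ∈ Gᶜ with t x' = t x, ‖c x'‖ ^ 2 :=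
          Finset.sum_nonneg fun _ _ => by positivity
        linarith [mul_le_mul h2 h1 (by positivity) (by positivity)]
      · push Not at h
        have h1 : (Gᶜ.filter fun x => t x = s) = Finset.univ.filter fun x => t x = s := by
          ext x
          simp only [Finset.mem_filter, Finset.mem_compl, Finset.mem_univ, true_and,
            and_iff_right_iff_imp]
          exact fun hx hxG => h x hxG hx
        rw [h1, hclass]
        have h2 : ((Fintype.card {x // t x = s} % Fintype.card Y : ℕ) : ℝ) ≤
            Fintype.card {x // t x = s} := by exact_mod_cast Nat.mod_le _ _
        have h3 : (0 : ℝ) ≤ Fintype.card Y * τ := by positivity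
        linarith [mul_le_mul_of_nonneg_right h2 (sq_nonneg ‖c₀ s‖)]
    rw [hdm]
    linarith
  refine le_trans (le_of_eq ?_) (Finset.sum_le_sum fun s _ => hs s)
  rw [Finset.sum_sub_distrib, Finset.sum_add_distrib, Finset.sum_const, nsmul_eq_mul,
    Finset.card_univ, Finset.sum_fiberwise]
  simp only [← hclass]
  rw [Finset.sum_fiberwise, hc1]

end Concentration

/-! ### Distillable entanglement of pure states -/

lemma copiesDensity_pureDensity {A B : Type} (ψ : A × B → ℂ) (m : ℕ) :
    copiesDensity (pureDensity ψ) m = pureDensity (copies ψ m) := by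
  ext x y
  simp [copiesDensity, copies, pureDensity_apply, Finset.prod_mul_distrib]

section Distillation

open Filter

variable {A B : Type} [Fintype A] [DecidableEq A] [Fintype B] [DecidableEq B]
  {ψ : A × B → ℂ} {σ : A ≃ B} {g : A → ℂ}

lemma copies_of_schmidt {A B : Type} [DecidableEq B] {ψ : A × B → ℂ} {σ : A ≃ B} {g : A → ℂ}
    (hψ : ∀ x, ψ x = if x.2 = σ x.1 then g x.1 else 0) (m : ℕ)
    (x : (Fin m → A) × (Fin m → B)) :
    copies ψ m x =
      if x.2 = Equiv.piCongrRight (fun _ => σ) x.1 then ∏ k, g (x.1 k) else 0 := by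
  simp only [copies, hψ]
  split_ifs with h
  · exact Finset.prod_congr rfl fun k _ => if_pos (by simp [h])
  · obtain ⟨k, hk⟩ := Function.ne_iff.1 h
    exact Finset.prod_eq_zero (Finset.mem_univ k) (if_neg hk)

lemma norm_sq_prod_seq {A : Type} {g : A → ℂ} {m : ℕ} (x : Fin m → A) :
    ‖∏ k, g (x k)‖ ^ 2 = ∏ k, ‖g (x k)‖ ^ 2 := by
  rw [norm_prod, Finset.prod_pow]

/-- At a rate above the entropy the rank `2 ^ n` of the target outgrows the number of typical
sequences, so that the fidelity even tends to zero. -/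
lemma IsDistillationRate.le_shannonEntropy
    (hψ : ∀ x, ψ x = if x.2 = σ x.1 then g x.1 else 0) (hg : ∑ a, ‖g a‖ ^ 2 = 1) {R : ℝ≥0}
    (hR : IsDistillationRate (pureDensity ψ) R) :
    (R : ℝ) ≤ shannonEntropy fun a => ‖g a‖ ^ 2 := by
  obtain ⟨n, Λ, hΛ, hn, hF⟩ := hR
  by_contra! hlt
  set p : A → ℝ := fun a => ‖g a‖ ^ 2 with hp
  have hp0 : ∀ a, 0 ≤ p a := fun a => by positivity
  set δ : ℝ := (R - shannonEntropy p) / 3 with hδdef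
  have hδ : 0 < δ := by
    rw [hδdef]
    linarith
  have hbound : ∀ m, fidelity (copies epr (n m)) (Λ m (copiesDensity (pureDensity ψ) m)) ≤
      2 * (2 ^ (m * (shannonEntropy p + δ)) / 2 ^ n m +
        ∑ x ∈ (typicalSet p δ m)ᶜ, ∏ k, p (x k)) := by
    intro m
    rw [copiesDensity_pureDensity, copies_epr]
    refine ((hΛ m).fidelity_maxEntangled_le (g := fun x : Fin m → A => ∏ k, g (x k))
      (copies_of_schmidt hψ m) ?_
      (typicalSet p δ m)).trans ?_
    · simp only [norm_sq_prod_seq]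
      exact sum_prod_seq hg m
    · simp only [norm_sq_prod_seq, Fintype.card_fun, Fintype.card_fin]
      push_cast
      gcongr
      exact card_typicalSet_le hp0 hg
  have hsmall : Tendsto (fun m : ℕ => (2 : ℝ) ^ (m * (shannonEntropy p + δ)) / 2 ^ n m) atTop
      (nhds 0) := by
    have hgeom : Tendsto (fun m : ℕ => ((2 : ℝ) ^ (-δ)) ^ m) atTop (nhds 0) :=
      tendsto_pow_atTop_nhds_zero_of_lt_one (by positivity)
        (Real.rpow_lt_one_of_one_lt_of_neg one_lt_two (by linarith))
    refine squeeze_zero' (.of_forall fun m => by positivity) ?_ hgeom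
    filter_upwards [hn.eventually_const_lt (show shannonEntropy p + 2 * δ < R by
      rw [hδdef]; linarith), eventually_gt_atTop 0] with m hm hm0
    have hm0' : (0 : ℝ) < m := by exact_mod_cast hm0
    rw [lt_div_iff₀ hm0'] at hm
    rw [← Real.rpow_natCast 2 (n m), ← Real.rpow_sub two_pos, ← Real.rpow_natCast,
      ← Real.rpow_mul zero_le_two]
    refine Real.rpow_le_rpow_of_exponent_le one_le_two ?_
    linarith
  have hzero := (hsmall.add (tendsto_sum_compl_typicalSet hp0 hg hδ)).const_mul 2
  have h10 := le_of_tendsto_of_tendsto' hF hzero hbound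
  norm_num at h10

/-- The number of types of sequences of length `m` grows polynomially only, and is hence beaten by
any exponential decay. -/
lemma tendsto_succ_pow_mul_pow (d : ℕ) {r : ℝ} (hr0 : 0 < r) (hr1 : r < 1) :
    Tendsto (fun m : ℕ => ((m : ℝ) + 1) ^ d * r ^ m) atTop (nhds 0) := by
  have h := ((tendsto_pow_const_mul_const_pow_of_lt_one d hr0.le hr1).comp
    (tendsto_add_atTop_nat 1)).mul_const r⁻¹
  rw [zero_mul] at h
  refine h.congr fun m => ?_
  simp only [Function.comp_apply, Nat.cast_add, Nat.cast_one, pow_succ r]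
  field_simp

lemma sum_norm_sq_of_schmidt {A B : Type} [Fintype A] [Fintype B] [DecidableEq B]
    {ψ : A × B → ℂ} {σ : A ≃ B} {g : A → ℂ} (hψ : ∀ x, ψ x = if x.2 = σ x.1 then g x.1 else 0) :
    ∑ x, ‖ψ x‖ ^ 2 = ∑ a, ‖g a‖ ^ 2 := by
  rw [Fintype.sum_prod_type]
  refine Finset.sum_congr rfl fun a _ => ?_
  rw [Finset.sum_eq_single (σ a)]
  · simp [hψ]
  · intro b _ hb
    simp [hψ, hb]
  · simp

/-- Entanglement concentration for `m` copies of a state in Schmidt form. -/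
lemma exists_isLOCC_le_fidelity_copies
    (hψ : ∀ x, ψ x = if x.2 = σ x.1 then g x.1 else 0) (hg : ∑ a, ‖g a‖ ^ 2 = 1) {p : A → ℝ}
    (hp : ∀ a, p a = ‖g a‖ ^ 2) (δ : ℝ) (m n : ℕ) :
    ∃ Λ : Matrix ((Fin m → A) × (Fin m → B)) ((Fin m → A) × (Fin m → B)) ℂ →
        Matrix ((Fin n → Fin 2) × (Fin n → Fin 2)) ((Fin n → Fin 2) × (Fin n → Fin 2)) ℂ,
      IsLOCC Λ ∧
      1 - (∑ x ∈ (typicalSet p δ m)ᶜ, ∏ k, p (x k) + ((m : ℝ) + 1) ^ Fintype.card A *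
          (2 ^ n * 2 ^ (-(m * (shannonEntropy p - δ))))) ≤
        fidelity (copies epr n) (Λ (copiesDensity (pureDensity ψ) m)) ∧
      fidelity (copies epr n) (Λ (copiesDensity (pureDensity ψ) m)) ≤ 1 := by
  -- The class of a sequence is its type: the number of occurrences of each letter.
  let t : (Fin m → A) → A → Fin (m + 1) := fun x a =>
    ⟨(Finset.univ.filter fun k => x k = a).card,
      Nat.lt_succ_of_le ((Finset.card_le_univ _).trans_eq (Fintype.card_fin m))⟩
  have ht : ∀ x : Fin m → A, ∏ k, g (x k) = ∏ a, g a ^ (t x a : ℕ) := fun x => by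
    simp only [t, ← Finset.prod_const, Finset.prod_fiberwise']
  have hnorm : ∀ x : Fin m → A, ‖∏ k, g (x k)‖ ^ 2 = ∏ k, p (x k) := fun x => by
    simp only [norm_prod, Finset.prod_pow, hp]
  have hone : ∑ x : Fin m → A, ‖∏ k, g (x k)‖ ^ 2 = 1 := by
    simp only [hnorm]
    exact sum_prod_seq (by simpa only [hp] using hg) m
  have hG : ∀ x ∈ typicalSet p δ m, ‖∏ k, g (x k)‖ ^ 2 ≤
      (2 : ℝ) ^ (-(m * (shannonEntropy p - δ))) := fun x hx => by
    rw [hnorm]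
    exact prod_le_of_mem_typicalSet hx
  have hS := copies_of_schmidt hψ m
  have hτ : (0 : ℝ) ≤ 2 ^ (-(m * (shannonEntropy p - δ))) := by positivity
  have key := exists_isLOCC_le_fidelity (Y := Fin n → Fin 2) hS hone
    (c₀ := fun s : A → Fin (m + 1) => ∏ a, g a ^ (s a : ℕ)) ht hτ hG
  rw [copiesDensity_pureDensity, copies_epr]
  have hunit : ∑ x, ‖copies ψ m x‖ ^ 2 = 1 :=
    (sum_norm_sq_of_schmidt (g := fun x : Fin m → A => ∏ k, g (x k)) hS).trans hone
  refine key.imp fun Λ h => ⟨h.1, ?_, h.1.fidelity_maxEntangled_le_one hunit⟩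
  have hF := h.2
  simp only [hnorm, Fintype.card_fun, Fintype.card_fin, Nat.cast_pow, Nat.cast_add, Nat.cast_one,
    Nat.cast_ofNat] at hF
  exact hF

/-- At a rate below the entropy one incomplete block for each type has vanishing weight. -/
lemma isDistillationRate_of_lt_shannonEntropy
    (hψ : ∀ x, ψ x = if x.2 = σ x.1 then g x.1 else 0) (hg : ∑ a, ‖g a‖ ^ 2 = 1) {R : ℝ≥0}
    (hR : (R : ℝ) < shannonEntropy fun a => ‖g a‖ ^ 2) :
    IsDistillationRate (pureDensity ψ) R := by
  set p : A → ℝ := fun a => ‖g a‖ ^ 2 with hp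
  have hp0 : ∀ a, 0 ≤ p a := fun a => by positivity
  set δ : ℝ := (shannonEntropy p - R) / 2 with hδdef
  have hδ : 0 < δ := by
    rw [hδdef]
    linarith
  choose Λ hΛ hF hF1 using fun m : ℕ =>
    exists_isLOCC_le_fidelity_copies hψ hg (p := p) (fun _ => rfl) δ m ⌊(R : ℝ) * m⌋₊
  refine ⟨fun m => ⌊(R : ℝ) * m⌋₊, Λ, hΛ,
    (tendsto_nat_floor_mul_div_atTop R.2).comp tendsto_natCast_atTop_atTop, ?_⟩
  have hloss : Tendsto (fun m : ℕ => 1 - (∑ x ∈ (typicalSet p δ m)ᶜ, ∏ k, p (x k) +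
      ((m : ℝ) + 1) ^ Fintype.card A * ((2 : ℝ) ^ (-δ)) ^ m)) atTop (nhds 1) := by
    simpa using ((tendsto_sum_compl_typicalSet hp0 hg hδ).add (tendsto_succ_pow_mul_pow
      (Fintype.card A) (by positivity : (0 : ℝ) < 2 ^ (-δ))
      (Real.rpow_lt_one_of_one_lt_of_neg one_lt_two (by linarith)))).const_sub 1
  refine tendsto_of_tendsto_of_tendsto_of_le_of_le hloss tendsto_const_nhds (fun m => ?_) hF1
  refine le_trans ?_ (hF m)
  gcongr
  have hfloor : (⌊(R : ℝ) * m⌋₊ : ℝ) ≤ R * m := Nat.floor_le (by positivity)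
  rw [← Real.rpow_natCast 2 ⌊(R : ℝ) * m⌋₊, ← Real.rpow_add two_pos, ← Real.rpow_natCast _ m,
    ← Real.rpow_mul zero_le_two]
  refine Real.rpow_le_rpow_of_exponent_le one_le_two ?_
  have hm : (m : ℝ) * (shannonEntropy p - δ) = R * m + m * δ := by
    rw [hδdef]
    ring
  linarith

/-- The distillable entanglement of a pure state is the entropy of its squared Schmidt
coefficients. -/
theorem distillableEntanglement_of_schmidt
    (hψ : ∀ x, ψ x = if x.2 = σ x.1 then g x.1 else 0) (hg : ∑ a, ‖g a‖ ^ 2 = 1) :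
    distillableEntanglement (pureDensity ψ) =
      ENNReal.ofReal (shannonEntropy fun a => ‖g a‖ ^ 2) := by
  refine le_antisymm (iSup₂_le fun R hR => ?_) (ENNReal.le_of_forall_nnreal_lt fun R hR => ?_)
  · rw [← ENNReal.ofReal_coe_nnreal]
    exact ENNReal.ofReal_le_ofReal (hR.le_shannonEntropy hψ hg)
  · rw [← ENNReal.ofReal_coe_nnreal,
      ENNReal.ofReal_lt_ofReal_iff_of_nonneg (NNReal.coe_nonneg R)] at hR
    exact le_iSup₂ (f := fun (R : ℝ≥0) (_ : IsDistillationRate (pureDensity ψ) R) => (R : ℝ≥0∞)) R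
      (isDistillationRate_of_lt_shannonEntropy hψ hg hR)

end Distillation

/-! ### Entropy of the output state of a transducer -/

namespace Transducer

variable {T : Transducer}

lemma sum_norm_sq_amplitude (hO : T.extractionO = 1) (hM : T.extractionM = 1) :
    ∑ a, ‖T.amplitude a‖ ^ 2 = 1 := by
  simp [Fin.sum_univ_two, amplitude, norm_sq_scattering_zero_one hO hM,
    norm_sq_scattering_one_one hO hM]

lemma shannonEntropy_amplitude (hO : T.extractionO = 1) (hM : T.extractionM = 1) :
    (shannonEntropy fun a => ‖T.amplitude a‖ ^ 2) = binaryEntropy T.efficiency := by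
  simp [shannonEntropy, Fin.sum_univ_two, amplitude, norm_sq_scattering_zero_one hO hM,
    norm_sq_scattering_one_one hO hM, binaryEntropy]
  ring

lemma binaryEntropy_efficiency_nonneg (hO : T.extractionO = 1) (hM : T.extractionM = 1) :
    0 ≤ binaryEntropy T.efficiency := by
  have h0 := T.efficiency_nonneg
  have h1 := efficiency_le_one hO hM
  have hlog : ∀ x : ℝ, 0 ≤ x → x ≤ 1 → x * Real.logb 2 x ≤ 0 := fun x hx0 hx1 =>
    mul_nonpos_of_nonneg_of_nonpos hx0 (Real.logb_nonpos one_lt_two hx0 hx1)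
  have := hlog _ h0 h1
  have := hlog (1 - T.efficiency) (by linarith) (by linarith)
  rw [binaryEntropy]
  linarith

end Transducer

end QTransduction

open QTransduction in
theorem lemma4
    (orch client : Transducer)
    (hζO : orch.extractionO = 1) (hζM : orch.extractionM = 1)
    (l L : ℝ) (hl : 0 ≤ l) (hL : 0 < L) :
    (∃ u v : ℂ, ‖u‖ = 1 ∧ ‖v‖ = 1 ∧
      orch.outputState =
        (u * (√orch.efficiency : ℝ)) • (Pi.single (0, 1) 1 : Fin 2 × Fin 2 → ℂ) +
        (v * (√(1 - orch.efficiency) : ℝ)) • (Pi.single (1, 0) 1 : Fin 2 × Fin 2 → ℂ)) ∧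
    vonNeumannEntropy (reducedFst (pureDensity orch.outputState)) =
      binaryEntropy orch.efficiency ∧
    vonNeumannEntropy (reducedSnd (pureDensity orch.outputState)) =
      binaryEntropy orch.efficiency ∧
    distillableEntanglement (pureDensity orch.outputState) =
      ENNReal.ofReal (binaryEntropy orch.efficiency) ∧
    ∀ {Ω : Type*} [MeasurableSpace Ω] (P : MeasureTheory.Measure Ω)
      [MeasureTheory.IsProbabilityMeasure P] (generated transmitted converted : Set Ω),
      MeasurableSet generated → MeasurableSet transmitted → MeasurableSet converted →
      ProbabilityTheory.iIndepSet ![generated, transmitted, converted] P →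
      P generated = distillableEntanglement (pureDensity orch.outputState) →
      P transmitted = fiberTransmission l L →
      P converted = ENNReal.ofReal client.efficiency →
      P.real (generated ∩ transmitted ∩ converted) =
        binaryEntropy orch.efficiency * client.efficiency * Real.exp (-l / L) := by
  have hψ := orch.outputState_apply
  have hE := (distillableEntanglement_of_schmidt hψ
    (Transducer.sum_norm_sq_amplitude hζO hζM)).trans
      (congrArg ENNReal.ofReal (Transducer.shannonEntropy_amplitude hζO hζM))
  refine ⟨Transducer.outputState_eq_beamSplitter hζO hζM, ?_, ?_, hE, ?_⟩
  · rw [reducedFst_of_schmidt hψ, vonNeumannEntropy_diagonal]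
    exact Transducer.shannonEntropy_amplitude hζO hζM
  · rw [reducedSnd_of_schmidt hψ, vonNeumannEntropy_diagonal,
      ← Transducer.shannonEntropy_amplitude hζO hζM, shannonEntropy]
    exact congrArg Neg.neg (Equiv.sum_comp Fin.revPerm.symm fun a =>
      ‖orch.amplitude a‖ ^ 2 * Real.logb 2 (‖orch.amplitude a‖ ^ 2))
  · intro Ω _ P _ generated transmitted converted hg ht hc hind hPg hPt hPc
    rw [measureReal_inter_of_iIndepSet hg ht hc hind, MeasureTheory.measureReal_def,
      MeasureTheory.measureReal_def, MeasureTheory.measureReal_def, hPg, hPt, hPc, hE,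
      ENNReal.toReal_ofReal (Transducer.binaryEntropy_efficiency_nonneg hζO hζM),
      ENNReal.toReal_ofReal client.efficiency_nonneg, toReal_fiberTransmission hl hL]
    ring
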